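/- Let $(\mathcal S,\mathcal A,P,r,\rho_0,\gamma)$ be an infinite-horizon discounted Markov decision process with a measurable state space $\mathcal S$, a finite action space $\mathcal A$ (with all subsets measurable) carrying a metric $d$, transition probabilities $P(\cdot\mid s,a)$, a bounded measurable reward $r:\mathcal S\times\mathcal A\to\mathbb R$, initial state distribution $\rho_0$ and discount factor $\gamma\in[0,1)$. For a stochastic stationary policy $\pi$ (a Markov kernel $\pi(\cdot\mid s)$ from $\mathcal S$ to $\mathcal A$) consider trajectories with $a_t\sim\pi(\cdot\mid s_t)$ and $s_{t+1}\sim P(\cdot\mid s_t,a_t)$. Let $$\eta(\pi)=\mathbb E_{s_0\sim\rho_0}\Big[\sum_{t=0}^\infty\gamma^t r(s_t,a_t)\Big],\qquad A^\pi(s,a)=\mathbb E\Big[\sum_{t=0}^\infty\gamma^t r(s_t,a_t)\,\Big|\,s_0=s,a_0=a;\pi\Big]-\mathbb E\Big[\sum_{t=0}^\infty\gamma^t r(s_t,a_t)\,\Big|\,s_0=s;\pi\Big],$$ let $\rho^\pi=\sum_{t=0}^\infty\gamma^t\,\mathbb P(s_t\in\cdot)$ be the unnormalized discounted visitation measure of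 $\pi$ (with $s_0\sim\rho_0$), and for a second policy $\pi'$ let $$L_\pi(\pi')=\eta(\pi)+\int_{\mathcal S}\int_{\mathcal A}A^\pi(s,a)\,\pi'(da\mid s)\,\rho^\pi(ds).$$ Put $\epsilon=\sup_{s,a}|A^\pi(s,a)|$, $c=\frac{4\epsilon\gamma}{(1-\gamma)^2}$, $d_{\min}=\min_{a\neq a'}d(a,a')$ and $c_1=c/d_{\min}^2$ (with $c_1=0$ if there is only one action). For probability measures $\mu,\nu$ on $\mathcal A$ let $d_W(\mu,\nu)=\inf_\Pi\mathbb E_{(X,Y)\sim\Pi}[d(X,Y)]$, where $\Pi$ ranges over all joint distributions with marginals $\mu$ and $\nu$, and let $d_W^{\max}(\pi',\pi)=\sup_{s\in\mathcal S}d_W(\pi'(\cdot\mid s),\pi(\cdot\mid s))$. Then for all policies $\pi$ and $\pi'$, $$\eta(\pi')\ \ge\ L_\pi(\pi')-c_1\,\big(d_W^{\max}(\pi',\pi)\big)^2 .$$ -/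

import Mathlib

open MeasureTheory ProbabilityTheory

noncomputable section

/-- An infinite-horizon discounted Markov decision process with a general (measurable) state space
`S` and action space `A`: transition probabilities `P`, reward function `r`, distribution `ρ₀` of
the initial state, and discount factor `γ ∈ [0, 1)`. -/
structure MDP (S A : Type*) [MeasurableSpace S] [MeasurableSpace A] where
  /-- the transition probabilities `P (· | s, a)` -/
  P : Kernel (S × A) S
  /-- the reward function -/
  r : S × A → ℝ
  /-- the distribution of the initial state -/
  ρ₀ : Measure S
  /-- the discount factor -/
  γ : ℝ
  isMarkovKernel_P : IsMarkovKernel P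
  measurable_r : Measurable r
  isProbabilityMeasure_ρ₀ : IsProbabilityMeasure ρ₀
  γ_nonneg : 0 ≤ γ
  γ_lt_one : γ < 1

namespace MDP

variable {S A : Type*} [MeasurableSpace S] [MeasurableSpace A]

instance (M : MDP S A) : IsMarkovKernel M.P := M.isMarkovKernel_P

instance (M : MDP S A) : IsProbabilityMeasure M.ρ₀ := M.isProbabilityMeasure_ρ₀

/-- The transition kernel of the state-action chain under the (stochastic, stationary) policy `π`:
from `(s, a)`, draw `s' ∼ P (· | s, a)` and then `a' ∼ π (· | s')`. -/
def stepKernel (M : MDP S A) (π : Kernel S A) : Kernel (S × A) (S × A) :=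
  M.P.compProd (Kernel.prodMkLeft (S × A) π)

instance (M : MDP S A) (π : Kernel S A) [IsMarkovKernel π] : IsMarkovKernel (M.stepKernel π) := by
  unfold stepKernel; infer_instance

/-- The same transition, as a kernel from the history `(s₀, a₀), …, (sₙ, aₙ)`: it depends only on
the last pair `(sₙ, aₙ)`. -/
def historyKernel (M : MDP S A) (π : Kernel S A) (n : ℕ) :
    Kernel (Π _ : Finset.Iic n, S × A) (S × A) :=
  (M.stepKernel π).comap (fun h => h ⟨n, Finset.mem_Iic.2 le_rfl⟩) (measurable_pi_apply _)

instance (M : MDP S A) (π : Kernel S A) [IsMarkovKernel π] (n : ℕ) :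
    IsMarkovKernel (M.historyKernel π n) := by
  unfold historyKernel; infer_instance

/-- The law of the trajectory `(s₀, a₀), (s₁, a₁), …` when `(s₀, a₀) ∼ μ`, and afterwards
`sₜ₊₁ ∼ P (· | sₜ, aₜ)` and `aₜ₊₁ ∼ π (· | sₜ₊₁)`. -/
def trajLaw (M : MDP S A) (π : Kernel S A) [IsMarkovKernel π] (μ : Measure (S × A)) :
    Measure (ℕ → S × A) :=
  Kernel.trajMeasure (X := fun _ => S × A) μ (M.historyKernel π)

/-- The accumulated discounted reward `∑ₖ γᵏ r(sₖ, aₖ)` of a trajectory. -/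
def discountedReturn (M : MDP S A) (ω : ℕ → S × A) : ℝ :=
  ∑' k : ℕ, M.γ ^ k * M.r (ω k)

/-- The performance `η(π) = 𝔼[∑ₜ γᵗ r(sₜ, aₜ)]` with `s₀ ∼ ρ₀`, `a₀ ∼ π (· | s₀)`. -/
def performance (M : MDP S A) (π : Kernel S A) [IsMarkovKernel π] : ℝ :=
  ∫ ω, M.discountedReturn ω ∂(M.trajLaw π (M.ρ₀.compProd π))

/-- `𝔼[Rₜ | sₜ = s, aₜ = a; π]`; by time homogeneity, the expected return of the trajectory
started at `(s, a)`. -/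
def actionValue (M : MDP S A) (π : Kernel S A) [IsMarkovKernel π] (s : S) (a : A) : ℝ :=
  ∫ ω, M.discountedReturn ω ∂(M.trajLaw π (Measure.dirac (s, a)))

/-- `𝔼[Rₜ | sₜ = s; π]`; by time homogeneity, the expected return of the trajectory started at `s`
with the first action drawn from `π (· | s)`. -/
def stateValue (M : MDP S A) (π : Kernel S A) [IsMarkovKernel π] (s : S) : ℝ :=
  ∫ ω, M.discountedReturn ω ∂(M.trajLaw π ((Measure.dirac s).compProd π))

/-- The advantage function `A^π(s, a)`. -/
def advantage (M : MDP S A) (π : Kernel S A) [IsMarkovKernel π] (s : S) (a : A) : ℝ :=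
  M.actionValue π s a - M.stateValue π s

/-- The unnormalized discounted visitation measure `ρ^π = ∑ₜ γᵗ ℙ(sₜ ∈ ·)`, where `s₀ ∼ ρ₀` and
the actions are drawn from `π`. -/
def visitation (M : MDP S A) (π : Kernel S A) [IsMarkovKernel π] : Measure S :=
  Measure.sum fun t : ℕ =>
    ENNReal.ofReal (M.γ ^ t) • (M.trajLaw π (M.ρ₀.compProd π)).map (fun ω => (ω t).1)

/-- The local approximation `L_π(π') = η(π) + 𝔼_{s ∼ ρ^π, a ∼ π'} [A^π(s, a)]`. -/
def localApprox (M : MDP S A) (π π' : Kernel S A) [IsMarkovKernel π] : ℝ :=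
  M.performance π + ∫ s, ∫ a, M.advantage π s a ∂(π' s) ∂(M.visitation π)

/-- `ε = max_{s, a} |A^π(s, a)|` (a supremum, as the state space may be infinite). -/
def maxAdvantage (M : MDP S A) (π : Kernel S A) [IsMarkovKernel π] : ℝ :=
  ⨆ x : S × A, |M.advantage π x.1 x.2|

/-- The constant `c = 4 ε γ / (1 - γ)²`. -/
def trpoConst (M : MDP S A) (π : Kernel S A) [IsMarkovKernel π] : ℝ :=
  4 * M.maxAdvantage π * M.γ / (1 - M.γ) ^ 2

end MDP

/-- The Wasserstein metric: the infimum of `𝔼_Γ[d(X, Y)]` over all joint distributions `Γ` with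
marginals `μ` and `ν`. -/
def wassersteinDist {A : Type*} [MetricSpace A] [MeasurableSpace A] (μ ν : Measure A) : ℝ :=
  sInf {x : ℝ | ∃ Γ : Measure (A × A),
    Γ.map Prod.fst = μ ∧ Γ.map Prod.snd = ν ∧ x = ∫ p, dist p.1 p.2 ∂Γ}

/-- `d_W^max(π', π) = max_s d_W(π' (· | s), π (· | s))` (a supremum, as the state space may be
infinite). -/
def maxWassersteinDist {S A : Type*} [MeasurableSpace S] [MetricSpace A] [MeasurableSpace A]
    (π' π : Kernel S A) : ℝ :=
  ⨆ s : S, wassersteinDist (π' s) (π s)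

/-- `d_min`, the least distance between two distinct points of a finite metric space. With a
single point there is no such pair; the value is then `0`, and a quotient `c / d_min ^ 2` is `0`,
as with the convention `min ∅ = ∞`. -/
def minDist (A : Type*) [MetricSpace A] : ℝ :=
  sInf {x : ℝ | ∃ a a' : A, a ≠ a' ∧ x = dist a a'}

end

open MeasureTheory ProbabilityTheory

noncomputable section

/-! ### Averages, laws and discounted resolvents of a Markov kernel on bounded functions. -/

namespace ProbabilityTheory.Kernel

variable {X Y : Type*} [MeasurableSpace X] [MeasurableSpace Y]

/-! Write `P_π` for the kernel of the state chain, `R_π = ∑ γᵗ P_πᵗ` for its resolvent, `V_π` for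
the state value, `f` for the mean advantage over `π` of the actions of `π'`, and `w` for the maximal
Wasserstein distance divided by the least distance. Both sides are integrals against `ρ₀`: the local
approximation is that of `V_π + R_π f` (`integral_visitation`), while `η(π')` is that of `V_π + R_π'
f`, by the performance difference lemma (`stateValue_sub_stateValue`). It remains to bound `(R_π -
R_π') f` uniformly.

This is of second order in `w`. On a finite metric space a function bounded by `C` is Lipschitz with
constant `2C / d_min`, so its means under `π'` and `π` differ by at most `2Cw`. Hence `|f| ≤ 2εw`,
since the mean advantage of `π` over itself vanishes, and `P_π'` and `P_π` differ by at most `2Cw`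
on functions bounded by `C`. A contraction argument (`abs_sub_resolvent_le`) turns the latter into a
bound on the resolvents, which contributes the other factor `w`. -/

theorem integrable_of_abs_le {μ : Measure X} [IsFiniteMeasure μ] {g : X → ℝ} {B : ℝ}
    (hg : Measurable g) (hB : ∀ x, |g x| ≤ B) : Integrable g μ :=
  Integrable.of_bound hg.aestronglyMeasurable B (Filter.Eventually.of_forall hB)

theorem abs_integral_le_of_abs_le {μ : Measure X} [IsProbabilityMeasure μ] {g : X → ℝ} {B : ℝ}
    (hB : ∀ x, |g x| ≤ B) : |∫ x, g x ∂μ| ≤ B := by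
  have h := norm_integral_le_of_norm_le_const (μ := μ) (f := g) (C := B)
    (Filter.Eventually.of_forall hB)
  simpa using h

/-- The expectation of `g` after one step of the kernel `K`. -/
def average (K : Kernel X Y) (g : Y → ℝ) (x : X) : ℝ := ∫ y, g y ∂K x

theorem measurable_average (K : Kernel X Y) [IsSFiniteKernel K] {g : Y → ℝ} (hg : Measurable g) :
    Measurable (K.average g) :=
  hg.stronglyMeasurable.integral_kernel.measurable

theorem abs_average_le (K : Kernel X Y) [IsMarkovKernel K] {g : Y → ℝ} {B : ℝ}
    (hB : ∀ y, |g y| ≤ B) (x : X) : |K.average g x| ≤ B :=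
  abs_integral_le_of_abs_le hB

theorem average_sub (K : Kernel X Y) [IsMarkovKernel K] {g h : Y → ℝ} {B C : ℝ}
    (hg : Measurable g) (hB : ∀ y, |g y| ≤ B) (hh : Measurable h) (hC : ∀ y, |h y| ≤ C) (x : X) :
    K.average (fun y => g y - h y) x = K.average g x - K.average h x :=
  integral_sub (integrable_of_abs_le hg hB) (integrable_of_abs_le hh hC)

theorem integral_bind_eq_integral_average (K : Kernel X Y) [IsMarkovKernel K] (μ : Measure X)
    [IsProbabilityMeasure μ] {g : Y → ℝ} {B : ℝ} (hg : Measurable g) (hB : ∀ y, |g y| ≤ B) :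
    ∫ y, g y ∂(μ.bind K) = ∫ x, K.average g x ∂μ := by
  rw [← Measure.snd_compProd, Measure.snd,
    integral_map measurable_snd.aemeasurable hg.aestronglyMeasurable, Measure.integral_compProd]
  · rfl
  · exact integrable_of_abs_le (hg.comp measurable_snd) fun x => hB x.2

theorem measurable_average_iterate (K : Kernel X X) [IsSFiniteKernel K] {g : X → ℝ}
    (hg : Measurable g) (t : ℕ) : Measurable (K.average^[t] g) := by
  induction t with
  | zero => exact hg
  | succ t ih => rw [Function.iterate_succ_apply']; exact K.measurable_average ih

theorem abs_average_iterate_le (K : Kernel X X) [IsMarkovKernel K] {g : X → ℝ} {B : ℝ}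
    (hB : ∀ x, |g x| ≤ B) (t : ℕ) (x : X) : |K.average^[t] g x| ≤ B := by
  induction t generalizing x with
  | zero => exact hB x
  | succ t ih => rw [Function.iterate_succ_apply']; exact K.abs_average_le ih x

/-- The law at time `t` of the Markov chain with kernel `K` and initial law `μ`. -/
def iterLaw (K : Kernel X X) (μ : Measure X) : ℕ → Measure X
  | 0 => μ
  | t + 1 => (iterLaw K μ t).bind K

instance (K : Kernel X X) [IsMarkovKernel K] (μ : Measure X) [IsProbabilityMeasure μ] (t : ℕ) :
    IsProbabilityMeasure (K.iterLaw μ t) := by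
  induction t with
  | zero => assumption
  | succ t ih => unfold iterLaw; infer_instance

theorem iterLaw_succ_left (K : Kernel X X) (μ : Measure X) (t : ℕ) :
    K.iterLaw μ (t + 1) = K.iterLaw (μ.bind K) t := by
  induction t with
  | zero => rfl
  | succ t ih => rw [iterLaw, ih, iterLaw]

theorem integral_iterLaw (K : Kernel X X) [IsMarkovKernel K] (μ : Measure X)
    [IsProbabilityMeasure μ] {g : X → ℝ} {B : ℝ} (hg : Measurable g) (hB : ∀ x, |g x| ≤ B)
    (t : ℕ) : ∫ x, g x ∂(K.iterLaw μ t) = ∫ x, K.average^[t] g x ∂μ := by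
  induction t generalizing g with
  | zero => rfl
  | succ t ih =>
    rw [iterLaw, integral_bind_eq_integral_average K _ hg hB,
      ih (K.measurable_average hg) (K.abs_average_le hB), Function.iterate_succ_apply]

/-- The expected discounted sum `∑ₜ γᵗ 𝔼[g(xₜ)]` along the Markov chain with kernel `K`, as a
function of the initial state. -/
def resolvent (K : Kernel X X) (γ : ℝ) (g : X → ℝ) (x : X) : ℝ :=
  ∑' t : ℕ, γ ^ t * K.average^[t] g x

theorem abs_pow_mul_le {γ a B : ℝ} (h0 : 0 ≤ γ) (ha : |a| ≤ B) (t : ℕ) :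
    |γ ^ t * a| ≤ B * γ ^ t := by
  rw [abs_mul, abs_of_nonneg (pow_nonneg h0 t), mul_comm]
  exact mul_le_mul_of_nonneg_right ha (pow_nonneg h0 t)

theorem summable_pow_mul {γ B : ℝ} (h0 : 0 ≤ γ) (h1 : γ < 1) {a : ℕ → ℝ} (ha : ∀ t, |a t| ≤ B) :
    Summable fun t => γ ^ t * a t :=
  Summable.of_norm_bounded ((summable_geometric_of_lt_one h0 h1).mul_left B)
    fun t => abs_pow_mul_le h0 (ha t) t

theorem abs_tsum_pow_mul_le {γ B : ℝ} (h0 : 0 ≤ γ) (h1 : γ < 1) {a : ℕ → ℝ}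
    (ha : ∀ t, |a t| ≤ B) : |∑' t, γ ^ t * a t| ≤ B / (1 - γ) := by
  rw [← Real.norm_eq_abs, div_eq_mul_inv]
  exact tsum_of_norm_bounded ((hasSum_geometric_of_lt_one h0 h1).mul_left B)
    fun t => abs_pow_mul_le h0 (ha t) t

/-- Integration of a discounted sum term by term. -/
theorem integral_tsum_pow_mul {γ B : ℝ} (h0 : 0 ≤ γ) (h1 : γ < 1) {μ : Measure X}
    [IsProbabilityMeasure μ] {g : ℕ → X → ℝ} (hg : ∀ t, Measurable (g t))
    (hB : ∀ t x, |g t x| ≤ B) :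
    ∫ x, ∑' t, γ ^ t * g t x ∂μ = ∑' t, γ ^ t * ∫ x, g t x ∂μ := by
  have hint : ∀ t, Integrable (fun x => γ ^ t * g t x) μ := fun t =>
    (integrable_of_abs_le (hg t) (hB t)).const_mul _
  rw [← integral_tsum_of_summable_integral_norm hint]
  · simp_rw [integral_const_mul]
  · refine Summable.of_norm_bounded ((summable_geometric_of_lt_one h0 h1).mul_left B) fun t => ?_
    exact abs_integral_le_of_abs_le fun x => by
      rw [Real.norm_eq_abs, abs_abs]; exact abs_pow_mul_le h0 (hB t x) t

section resolvent

variable (K : Kernel X X) [IsMarkovKernel K] {γ B : ℝ} {g : X → ℝ}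

theorem abs_resolvent_le (h0 : 0 ≤ γ) (h1 : γ < 1) (hB : ∀ x, |g x| ≤ B) (x : X) :
    |K.resolvent γ g x| ≤ B / (1 - γ) :=
  abs_tsum_pow_mul_le h0 h1 fun t => K.abs_average_iterate_le hB t x

theorem measurable_resolvent (hg : Measurable g) : Measurable (K.resolvent γ g) :=
  Measurable.tsum fun t => (K.measurable_average_iterate hg t).const_mul _

theorem integral_resolvent (h0 : 0 ≤ γ) (h1 : γ < 1) (hg : Measurable g) (hB : ∀ x, |g x| ≤ B)
    (μ : Measure X) [IsProbabilityMeasure μ] :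
    ∫ x, K.resolvent γ g x ∂μ = ∑' t, γ ^ t * ∫ x, g x ∂(K.iterLaw μ t) := by
  simp_rw [K.integral_iterLaw μ hg hB]
  exact integral_tsum_pow_mul h0 h1 (K.measurable_average_iterate hg)
    (K.abs_average_iterate_le hB)

theorem resolvent_eq (h0 : 0 ≤ γ) (h1 : γ < 1) (hg : Measurable g) (hB : ∀ x, |g x| ≤ B) (x : X) :
    K.resolvent γ g x = g x + γ * K.average (K.resolvent γ g) x := by
  rw [resolvent, (summable_pow_mul h0 h1
    fun t => K.abs_average_iterate_le hB t x).tsum_eq_zero_add]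
  have : K.average (K.resolvent γ g) x = ∑' t, γ ^ t * K.average^[t + 1] g x := by
    simp_rw [Function.iterate_succ_apply']
    exact integral_tsum_pow_mul h0 h1 (K.measurable_average_iterate hg)
      (K.abs_average_iterate_le hB)
  rw [this, ← tsum_mul_left]
  simp [pow_succ', mul_assoc]

/-- A bounded approximate solution of the Bellman equation is close to the resolvent. -/
theorem abs_sub_resolvent_le (h0 : 0 ≤ γ) (h1 : γ < 1) (hg : Measurable g) (hB : ∀ x, |g x| ≤ B)
    {h : X → ℝ} {C δ : ℝ} (hh : Measurable h) (hC : ∀ x, |h x| ≤ C)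
    (hδ : ∀ x, |h x - (g x + γ * K.average h x)| ≤ δ) (x : X) :
    |h x - K.resolvent γ g x| ≤ δ / (1 - γ) := by
  have h1' : 0 < 1 - γ := by linarith
  have step : ∀ D, (∀ x, |h x - K.resolvent γ g x| ≤ D) →
      ∀ x, |h x - K.resolvent γ g x| ≤ δ + γ * D := by
    intro D hD x
    have e : h x - K.resolvent γ g x = (h x - (g x + γ * K.average h x)) +
        γ * K.average (fun y => h y - K.resolvent γ g y) x := by
      rw [K.average_sub hh hC (K.measurable_resolvent hg) (K.abs_resolvent_le h0 h1 hB),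
        K.resolvent_eq h0 h1 hg hB]
      ring
    rw [e]
    refine (abs_add_le _ _).trans (add_le_add (hδ x) ?_)
    rw [abs_mul, abs_of_nonneg h0]
    exact mul_le_mul_of_nonneg_left (K.abs_average_le hD x) h0
  have hbdd : BddAbove (Set.range fun x => |h x - K.resolvent γ g x|) := by
    refine ⟨C + B / (1 - γ), ?_⟩
    rintro _ ⟨y, rfl⟩
    exact (abs_sub _ _).trans (add_le_add (hC y) (K.abs_resolvent_le h0 h1 hB y))
  have : Nonempty X := ⟨x⟩
  -- With `D` the supremum itself, `step` gives `D ≤ δ + γ D`; `hbdd` makes `D` a genuine upper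
  -- bound.
  have hs := ciSup_le (step _ (le_ciSup hbdd))
  refine (le_ciSup hbdd x).trans ?_
  rw [le_div_iff₀ h1']
  linarith

end resolvent

end ProbabilityTheory.Kernel

/-! ### One-time marginals of trajectory measures. -/

namespace ProbabilityTheory.Kernel

theorem trajMeasure_map_zero {X : ℕ → Type*} [∀ n, MeasurableSpace (X n)] (μ : Measure (X 0))
    (κ : (n : ℕ) → Kernel (Π i : Finset.Iic n, X i) (X (n + 1))) [∀ n, IsMarkovKernel (κ n)] :
    (trajMeasure μ κ).map (fun ω => ω 0) = μ := by
  have h : (trajMeasure μ κ).map (Preorder.frestrictLe 0) =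
      μ.map (MeasurableEquiv.piUnique (fun i : Finset.Iic 0 => X i)).symm := by
    rw [trajMeasure, Measure.map_comp _ _ (by fun_prop), traj_map_frestrictLe, partialTraj_self,
      Measure.id_comp]
    rfl
  have e : (fun ω : Π n, X n => ω 0) =
      (fun x : Π i : Finset.Iic 0, X i => x ⟨0, by simp⟩) ∘ Preorder.frestrictLe 0 := rfl
  rw [e, ← Measure.map_map (by fun_prop) (by fun_prop), h]
  refine (Measure.map_map (measurable_pi_apply _) (MeasurableEquiv.measurable _)).trans ?_
  exact Measure.map_id

theorem trajMeasure_map_succ {X : ℕ → Type*} [∀ n, MeasurableSpace (X n)] (μ : Measure (X 0))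
    [IsProbabilityMeasure μ] (κ : (n : ℕ) → Kernel (Π i : Finset.Iic n, X i) (X (n + 1)))
    [∀ n, IsMarkovKernel (κ n)] (n : ℕ) :
    (trajMeasure μ κ).map (fun ω => ω (n + 1)) =
      ((trajMeasure μ κ).map (Preorder.frestrictLe n)).bind (κ n) := by
  have : IsProbabilityMeasure ((trajMeasure μ κ).map (Preorder.frestrictLe n)) :=
    Measure.isProbabilityMeasure_map (by fun_prop)
  rw [← Measure.snd_compProd, map_frestrictLe_trajMeasure_compProd_eq_map_trajMeasure,
    Measure.snd, Measure.map_map measurable_snd (by fun_prop)]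
  rfl

theorem bind_comap {X Y Z : Type*} [MeasurableSpace X] [MeasurableSpace Y] [MeasurableSpace Z]
    (K : Kernel Y Z) (μ : Measure X) {f : X → Y} (hf : Measurable f) :
    μ.bind (K.comap f hf) = (μ.map f).bind K := by
  ext s hs
  rw [Measure.bind_apply hs (Kernel.aemeasurable _), Measure.bind_apply hs (Kernel.aemeasurable _),
    MeasureTheory.lintegral_map (K.measurable_coe hs) hf]
  rfl

end ProbabilityTheory.Kernel

/-! ### Returns, values and visitation expressed through the state chain. -/

namespace MDP

open ProbabilityTheory.Kernel

variable {S A : Type*} [MeasurableSpace S] [MeasurableSpace A]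

instance (M : MDP S A) (π : Kernel S A) [IsMarkovKernel π] (μ : Measure (S × A))
    [IsProbabilityMeasure μ] : IsProbabilityMeasure (M.trajLaw π μ) := by
  unfold trajLaw; infer_instance

/-- The transition kernel of the state chain under the policy `π`. -/
def stateKernel (M : MDP S A) (π : Kernel S A) : Kernel S S := (π.compProd M.P).snd

variable (M : MDP S A) (π : Kernel S A) [IsMarkovKernel π]

instance : IsMarkovKernel (M.stateKernel π) := by
  unfold stateKernel; infer_instance

theorem map_trajLaw (μ : Measure (S × A)) [IsProbabilityMeasure μ] (t : ℕ) :
    (M.trajLaw π μ).map (fun ω => ω t) = (M.stepKernel π).iterLaw μ t := by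
  induction t with
  | zero => exact trajMeasure_map_zero (X := fun _ => S × A) μ (M.historyKernel π)
  | succ t ih =>
    rw [iterLaw, ← ih]
    refine (trajMeasure_map_succ (X := fun _ => S × A) μ (M.historyKernel π) t).trans ?_
    rw [historyKernel, bind_comap, Measure.map_map (measurable_pi_apply _) (by fun_prop)]
    rfl

/-- After one step the action is freshly drawn from `π`, whatever the initial law; this is what
reduces the state-action chain to the state chain. -/
theorem bind_stepKernel (μ : Measure (S × A)) [IsProbabilityMeasure μ] :
    μ.bind (M.stepKernel π) = (μ.bind M.P).compProd π := by
  ext s hs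
  rw [Measure.bind_apply hs (Kernel.aemeasurable _), Measure.compProd_apply hs,
    Measure.lintegral_bind (Kernel.aemeasurable _)
      (Kernel.measurable_kernel_prodMk_left hs).aemeasurable]
  refine lintegral_congr fun x => ?_
  rw [stepKernel, Kernel.compProd_apply hs]
  rfl

theorem average_stateKernel {g : S → ℝ} {B : ℝ} (hg : Measurable g) (hB : ∀ s, |g s| ≤ B)
    (s : S) : (M.stateKernel π).average g s = ∫ a, M.P.average g (s, a) ∂(π s) := by
  rw [Kernel.average, stateKernel, Kernel.snd_apply,
    integral_map measurable_snd.aemeasurable hg.aestronglyMeasurable,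
    ProbabilityTheory.integral_compProd]
  · rfl
  · exact integrable_of_abs_le (hg.comp measurable_snd) fun x => hB x.2

theorem bind_compProd (ρ : Measure S) [IsProbabilityMeasure ρ] :
    (ρ.compProd π).bind M.P = ρ.bind (M.stateKernel π) := by
  ext s hs
  rw [Measure.bind_apply hs (Kernel.aemeasurable _), Measure.bind_apply hs (Kernel.aemeasurable _),
    Measure.lintegral_compProd (M.P.measurable_coe hs)]
  refine lintegral_congr fun x => ?_
  rw [stateKernel, Kernel.snd_apply' _ _ hs, Kernel.compProd_apply (measurable_snd hs)]
  rfl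

theorem iterLaw_stepKernel (ρ : Measure S) [IsProbabilityMeasure ρ] (t : ℕ) :
    (M.stepKernel π).iterLaw (ρ.compProd π) t = ((M.stateKernel π).iterLaw ρ t).compProd π := by
  induction t with
  | zero => rfl
  | succ t ih => rw [iterLaw, ih, bind_stepKernel, bind_compProd]; rfl

/-- The expected immediate reward in the state `s` under the policy `π`. -/
def meanReward (s : S) : ℝ := ∫ a, M.r (s, a) ∂(π s)

theorem measurable_meanReward : Measurable (M.meanReward π) :=
  (M.measurable_r.stronglyMeasurable.integral_kernel_prod_right').measurable

theorem abs_meanReward_le {B : ℝ} (hr : ∀ x, |M.r x| ≤ B) (s : S) : |M.meanReward π s| ≤ B :=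
  abs_integral_le_of_abs_le fun _ => hr _

theorem integral_discountedReturn {B : ℝ} (hr : ∀ x, |M.r x| ≤ B) (μ : Measure (S × A))
    [IsProbabilityMeasure μ] :
    ∫ ω, M.discountedReturn ω ∂(M.trajLaw π μ) =
      ∑' t, M.γ ^ t * ∫ x, M.r x ∂((M.stepKernel π).iterLaw μ t) := by
  refine (integral_tsum_pow_mul (g := fun t (ω : ℕ → S × A) => M.r (ω t)) M.γ_nonneg M.γ_lt_one
    (fun t => M.measurable_r.comp (measurable_pi_apply t)) fun t ω => hr (ω t)).trans ?_
  congr! 3 with t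
  rw [← map_trajLaw, integral_map (measurable_pi_apply t).aemeasurable
    M.measurable_r.aestronglyMeasurable]

theorem integral_discountedReturn_compProd {B : ℝ} (hr : ∀ x, |M.r x| ≤ B) (ρ : Measure S)
    [IsProbabilityMeasure ρ] :
    ∫ ω, M.discountedReturn ω ∂(M.trajLaw π (ρ.compProd π)) =
      ∫ s, (M.stateKernel π).resolvent M.γ (M.meanReward π) s ∂ρ := by
  rw [integral_discountedReturn M π hr, integral_resolvent _ M.γ_nonneg M.γ_lt_one
    (M.measurable_meanReward π) (M.abs_meanReward_le π hr)]
  congr! 3 with t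
  rw [iterLaw_stepKernel, Measure.integral_compProd (integrable_of_abs_le M.measurable_r hr)]
  rfl

theorem stateValue_eq {B : ℝ} (hr : ∀ x, |M.r x| ≤ B) :
    M.stateValue π = (M.stateKernel π).resolvent M.γ (M.meanReward π) := by
  funext s
  rw [stateValue, integral_discountedReturn_compProd M π hr, integral_dirac']
  exact (measurable_resolvent _ (M.measurable_meanReward π)).stronglyMeasurable

theorem performance_eq {B : ℝ} (hr : ∀ x, |M.r x| ≤ B) :
    M.performance π = ∫ s, M.stateValue π s ∂M.ρ₀ := by
  rw [performance, integral_discountedReturn_compProd M π hr, stateValue_eq M π hr]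

theorem measurable_stateValue {B : ℝ} (hr : ∀ x, |M.r x| ≤ B) : Measurable (M.stateValue π) := by
  rw [stateValue_eq M π hr]
  exact measurable_resolvent _ (M.measurable_meanReward π)

theorem abs_stateValue_le {B : ℝ} (hr : ∀ x, |M.r x| ≤ B) (s : S) :
    |M.stateValue π s| ≤ B / (1 - M.γ) := by
  rw [stateValue_eq M π hr]
  exact abs_resolvent_le _ M.γ_nonneg M.γ_lt_one (M.abs_meanReward_le π hr) s

/-- The term at time 0 splits off; one step later the law is `P (· | s, a)` followed by `π`, whose
return is the mean of the state value. -/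
theorem actionValue_eq {B : ℝ} (hr : ∀ x, |M.r x| ≤ B) (s : S) (a : A) :
    M.actionValue π s a = M.r (s, a) + M.γ * M.P.average (M.stateValue π) (s, a) := by
  have hdirac : (Measure.dirac (s, a)).bind (M.stepKernel π) = (M.P (s, a)).compProd π := by
    rw [bind_stepKernel, Measure.dirac_bind M.P.measurable]
  rw [actionValue, integral_discountedReturn M π hr,
    (summable_pow_mul M.γ_nonneg M.γ_lt_one fun t => abs_integral_le_of_abs_le hr).tsum_eq_zero_add,
    Kernel.average, stateValue_eq M π hr, ← integral_discountedReturn_compProd M π hr,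
    integral_discountedReturn M π hr, ← tsum_mul_left]
  simp_rw [iterLaw_succ_left, hdirac]
  rw [iterLaw, integral_dirac' _ _ M.measurable_r.stronglyMeasurable]
  simp [pow_succ', mul_assoc]

theorem integral_visitation {f : S → ℝ} {B : ℝ} (hf : Measurable f) (hB : ∀ s, |f s| ≤ B) :
    ∫ s, f s ∂(M.visitation π) = ∫ s, (M.stateKernel π).resolvent M.γ f s ∂M.ρ₀ := by
  have hlaw : ∀ t, (M.trajLaw π (M.ρ₀.compProd π)).map (fun ω => (ω t).1) =
      (M.stateKernel π).iterLaw M.ρ₀ t := fun t => by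
    have : (fun ω : ℕ → S × A => (ω t).1) = Prod.fst ∘ fun ω => ω t := rfl
    rw [this, ← Measure.map_map measurable_fst (measurable_pi_apply t), map_trajLaw,
      iterLaw_stepKernel, ← Measure.fst, Measure.fst_compProd]
  rw [integral_resolvent _ M.γ_nonneg M.γ_lt_one hf hB, visitation]
  simp_rw [hlaw]
  -- The total mass is a convergent geometric series, so bounded functions are integrable and the
  -- integral may be summed over time.
  have hfin : IsFiniteMeasure (Measure.sum fun t : ℕ =>
      ENNReal.ofReal (M.γ ^ t) • (M.stateKernel π).iterLaw M.ρ₀ t) := by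
    refine ⟨?_⟩
    rw [Measure.sum_apply _ MeasurableSet.univ]
    simp only [Measure.smul_apply, measure_univ, smul_eq_mul, mul_one]
    exact (summable_geometric_of_lt_one M.γ_nonneg M.γ_lt_one).tsum_ofReal_lt_top
  rw [integral_sum_measure (integrable_of_abs_le hf hB)]
  congr! 2 with t
  rw [integral_smul_measure, ENNReal.toReal_ofReal (pow_nonneg M.γ_nonneg t), smul_eq_mul]

end MDP

open ProbabilityTheory.Kernel

/-! ### Wasserstein distance on a finite metric space. -/

section Wasserstein

variable {A : Type*} [MetricSpace A]

theorem minDist_le_dist {x y : A} (hxy : x ≠ y) : minDist A ≤ dist x y := by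
  refine csInf_le ⟨0, ?_⟩ ⟨x, y, hxy, rfl⟩
  rintro _ ⟨a, a', -, rfl⟩
  exact dist_nonneg

theorem minDist_nonneg : 0 ≤ minDist A := by
  refine Real.sInf_nonneg ?_
  rintro _ ⟨a, a', -, rfl⟩
  exact dist_nonneg

theorem minDist_pos_of_ne [Finite A] {x y : A} (hxy : x ≠ y) : 0 < minDist A := by
  have hfin : {d : ℝ | ∃ a a' : A, a ≠ a' ∧ d = dist a a'}.Finite := by
    refine (Set.finite_range fun p : A × A => dist p.1 p.2).subset ?_
    rintro _ ⟨a, a', -, rfl⟩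
    exact ⟨(a, a'), rfl⟩
  obtain ⟨a, a', h, e⟩ := Set.Nonempty.csInf_mem (s := {d | ∃ a a' : A, a ≠ a' ∧ d = dist a a'})
    ⟨_, x, y, hxy, rfl⟩ hfin
  rw [minDist, e]
  exact dist_pos.2 h

/-- Distinct points are at least `minDist A` apart. If there is only one point, the division by zero
is harmless: both sides vanish. -/
theorem abs_sub_le_div_minDist_mul_dist [Finite A] {g : A → ℝ} {C : ℝ} (hC : ∀ a, |g a| ≤ C) (x y : A) :
    |g x - g y| ≤ 2 * C / minDist A * dist x y := by
  rcases eq_or_ne x y with rfl | hxy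
  · simp
  have hpos := minDist_pos_of_ne hxy
  have hC0 : 0 ≤ C := (abs_nonneg _).trans (hC x)
  calc |g x - g y| ≤ |g x| + |g y| := abs_sub _ _
    _ ≤ 2 * C / minDist A * minDist A := by
      rw [div_mul_cancel₀ _ hpos.ne']; linarith [hC x, hC y]
    _ ≤ _ := mul_le_mul_of_nonneg_left (minDist_le_dist hxy) (by positivity)

variable [MeasurableSpace A]

theorem wassersteinDist_le_of_dist_le {D : ℝ} (hD : ∀ x y : A, dist x y ≤ D) (μ ν : Measure A)
    [IsProbabilityMeasure μ] [IsProbabilityMeasure ν] : wassersteinDist μ ν ≤ D := by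
  have h : wassersteinDist μ ν ≤ ∫ p, dist p.1 p.2 ∂(μ.prod ν) := by
    refine csInf_le ⟨0, ?_⟩ ⟨μ.prod ν, by simp, by simp, rfl⟩
    rintro _ ⟨Γ, -, -, rfl⟩
    exact integral_nonneg fun _ => dist_nonneg
  exact h.trans <| (le_abs_self _).trans (abs_integral_le_of_abs_le fun p => by
    rw [abs_of_nonneg dist_nonneg]; exact hD _ _)

theorem wassersteinDist_le_maxWassersteinDist [Finite A] {S : Type*} [MeasurableSpace S] (π' π : Kernel S A)
    [IsMarkovKernel π'] [IsMarkovKernel π] (s : S) :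
    wassersteinDist (π' s) (π s) ≤ maxWassersteinDist π' π := by
  obtain ⟨D, hD⟩ := (Set.finite_range fun p : A × A => dist p.1 p.2).bddAbove
  refine le_ciSup (f := fun s => wassersteinDist (π' s) (π s)) ⟨D, ?_⟩ s
  rintro _ ⟨s, rfl⟩
  exact wassersteinDist_le_of_dist_le (fun x y => hD ⟨(x, y), rfl⟩) _ _

variable [Finite A] [DiscreteMeasurableSpace A]

/-- Two probability measures that are close in the Wasserstein metric give close expectations to
a bounded function on a finite metric space. -/
theorem abs_integral_sub_integral_le_wassersteinDist (μ ν : Measure A) [IsProbabilityMeasure μ]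
    [IsProbabilityMeasure ν] {g : A → ℝ} {C : ℝ} (hC : ∀ a, |g a| ≤ C) :
    |∫ a, g a ∂μ - ∫ a, g a ∂ν| ≤ 2 * C / minDist A * wassersteinDist μ ν := by
  have hA : Nonempty A := nonempty_of_isProbabilityMeasure μ
  have hC0 : 0 ≤ C := (abs_nonneg _).trans (hC hA.some)
  have hk : 0 ≤ 2 * C / minDist A := div_nonneg (by positivity) minDist_nonneg
  -- With the constant moved inside the infimum, it suffices to compare with each coupling; the
  -- product coupling shows that one exists.
  rw [wassersteinDist, ← smul_eq_mul (2 * C / minDist A), ← Real.sInf_smul_of_nonneg hk]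
  refine le_csInf (Set.Nonempty.smul_set ⟨_, μ.prod ν, by simp, by simp, rfl⟩) ?_
  rintro _ ⟨_, ⟨Γ, h₁, h₂, rfl⟩, rfl⟩
  have hΓ : IsProbabilityMeasure Γ := by
    refine ⟨?_⟩
    rw [← Set.preimage_univ (f := Prod.fst), ← Measure.map_apply measurable_fst MeasurableSet.univ,
      h₁, measure_univ]
  have hg : Measurable g := .of_discrete
  have hint : ∀ h : A × A → ℝ, Integrable h Γ := fun h => .of_finite
  rw [← h₁, ← h₂, integral_map measurable_fst.aemeasurable hg.aestronglyMeasurable,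
    integral_map measurable_snd.aemeasurable hg.aestronglyMeasurable,
    ← integral_sub (hint _) (hint _)]
  refine abs_integral_le_integral_abs.trans ?_
  simp only [smul_eq_mul]
  rw [← integral_const_mul]
  exact integral_mono (hint _) (hint _) fun p => abs_sub_le_div_minDist_mul_dist hC p.1 p.2

theorem abs_integral_sub_integral_le_maxWassersteinDist {S : Type*} [MeasurableSpace S]
    (π' π : Kernel S A) [IsMarkovKernel π'] [IsMarkovKernel π] {g : A → ℝ} {C : ℝ}
    (hC : ∀ a, |g a| ≤ C) (s : S) :
    |∫ a, g a ∂(π' s) - ∫ a, g a ∂(π s)| ≤ 2 * C * (maxWassersteinDist π' π / minDist A) := by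
  have hA : Nonempty A := nonempty_of_isProbabilityMeasure (π s)
  have hC0 : 0 ≤ C := (abs_nonneg _).trans (hC hA.some)
  refine (abs_integral_sub_integral_le_wassersteinDist _ _ hC).trans ?_
  rw [mul_div_assoc', div_mul_eq_mul_div]
  exact div_le_div_of_nonneg_right (mul_le_mul_of_nonneg_left
    (wassersteinDist_le_maxWassersteinDist π' π s) (by positivity)) minDist_nonneg

end Wasserstein

/-! ### Advantages and the performance difference lemma. -/

namespace MDP

variable {S A : Type*} [MeasurableSpace S] [MeasurableSpace A]
  (M : MDP S A) (π π' : Kernel S A) [IsMarkovKernel π] [IsMarkovKernel π']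

theorem advantage_eq {B : ℝ} (hr : ∀ x, |M.r x| ≤ B) (s : S) (a : A) :
    M.advantage π s a =
      M.r (s, a) + M.γ * M.P.average (M.stateValue π) (s, a) - M.stateValue π s := by
  rw [advantage, actionValue_eq M π hr]

theorem measurable_advantage {B : ℝ} (hr : ∀ x, |M.r x| ≤ B) :
    Measurable fun x : S × A => M.advantage π x.1 x.2 := by
  simp_rw [advantage_eq M π hr]
  exact (M.measurable_r.add ((measurable_average _ (M.measurable_stateValue π hr)).const_mul _)).sub
    ((M.measurable_stateValue π hr).comp measurable_fst)

theorem abs_advantage_le_maxAdvantage {B : ℝ} (hr : ∀ x, |M.r x| ≤ B) (s : S) (a : A) :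
    |M.advantage π s a| ≤ M.maxAdvantage π := by
  refine le_ciSup (f := fun x : S × A => |M.advantage π x.1 x.2|)
    ⟨B + M.γ * (B / (1 - M.γ)) + B / (1 - M.γ), ?_⟩ (s, a)
  rintro _ ⟨x, rfl⟩
  dsimp only
  rw [advantage_eq M π hr]
  refine (abs_sub _ _).trans (add_le_add ((abs_add_le _ _).trans (add_le_add (hr _) ?_))
    (M.abs_stateValue_le π hr _))
  rw [abs_mul, abs_of_nonneg M.γ_nonneg]
  exact mul_le_mul_of_nonneg_left (abs_average_le _ (M.abs_stateValue_le π hr) _) M.γ_nonneg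

theorem stateValue_bellman {B : ℝ} (hr : ∀ x, |M.r x| ≤ B) (s : S) :
    M.stateValue π s =
      M.meanReward π s + M.γ * (M.stateKernel π).average (M.stateValue π) s := by
  rw [stateValue_eq M π hr]
  exact resolvent_eq _ M.γ_nonneg M.γ_lt_one (M.measurable_meanReward π)
    (M.abs_meanReward_le π hr) s

/-- The expected advantage over `π` of the actions chosen by `π'`. -/
def meanAdvantage (s : S) : ℝ := ∫ a, M.advantage π s a ∂(π' s)

theorem measurable_meanAdvantage {B : ℝ} (hr : ∀ x, |M.r x| ≤ B) :
    Measurable (M.meanAdvantage π π') :=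
  ((M.measurable_advantage π hr).stronglyMeasurable.integral_kernel_prod_right').measurable

theorem meanAdvantage_eq {B : ℝ} (hr : ∀ x, |M.r x| ≤ B) (s : S) :
    M.meanAdvantage π π' s =
      M.meanReward π' s + M.γ * (M.stateKernel π').average (M.stateValue π) s -
        M.stateValue π s := by
  have hV := M.measurable_stateValue π hr
  have h₁ : Integrable (fun a => M.r (s, a)) (π' s) :=
    integrable_of_abs_le (M.measurable_r.comp measurable_prodMk_left) fun a => hr (s, a)
  have h₂ : Integrable (fun a => M.γ * M.P.average (M.stateValue π) (s, a)) (π' s) :=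
    (integrable_of_abs_le ((measurable_average M.P hV).comp measurable_prodMk_left)
      fun a => abs_average_le M.P (M.abs_stateValue_le π hr) (s, a)).const_mul _
  unfold meanAdvantage
  simp_rw [advantage_eq M π hr]
  have h₃ := integral_sub (h₁.add h₂) (integrable_const (M.stateValue π s))
  simp only [Pi.add_apply] at h₃
  rw [h₃, integral_add h₁ h₂, integral_const_mul,
    ← average_stateKernel M π' hV (M.abs_stateValue_le π hr)]
  simp [meanReward]

theorem meanAdvantage_self {B : ℝ} (hr : ∀ x, |M.r x| ≤ B) (s : S) :
    M.meanAdvantage π π s = 0 := by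
  rw [meanAdvantage_eq M π π hr, ← stateValue_bellman M π hr, sub_self]

/-- The performance difference lemma: the gain of `π'` over `π` is the expected discounted sum,
along `π'`, of the advantages over `π`. -/
theorem stateValue_sub_stateValue {B : ℝ} (hr : ∀ x, |M.r x| ≤ B) {C : ℝ}
    (hC : ∀ s, |M.meanAdvantage π π' s| ≤ C) (s : S) :
    M.stateValue π' s - M.stateValue π s =
      (M.stateKernel π').resolvent M.γ (M.meanAdvantage π π') s := by
  have hV := M.measurable_stateValue π hr
  have hV' := M.measurable_stateValue π' hr
  -- The difference of values solves the Bellman equation of `π'` with source `meanAdvantage`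
  -- exactly, so the defect `δ` is 0.
  have h := abs_sub_resolvent_le (M.stateKernel π') M.γ_nonneg M.γ_lt_one
    (M.measurable_meanAdvantage π π' hr) hC (hV'.sub hV) (C := B / (1 - M.γ) + B / (1 - M.γ))
    (fun s => (abs_sub _ _).trans
      (add_le_add (M.abs_stateValue_le π' hr s) (M.abs_stateValue_le π hr s)))
    (δ := 0) (fun s => ?_) s
  · rw [zero_div] at h
    exact sub_eq_zero.1 (abs_nonpos_iff.1 h)
  · have e := average_sub (M.stateKernel π') hV' (M.abs_stateValue_le π' hr) hV
      (M.abs_stateValue_le π hr) s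
    rw [abs_nonpos_iff, meanAdvantage_eq M π π' hr]
    simp only [Pi.sub_apply]
    change _ - (_ + M.γ * (M.stateKernel π').average
      (fun s => M.stateValue π' s - M.stateValue π s) s) = 0
    rw [e, stateValue_bellman M π' hr s]
    ring

end MDP

/-! ### Perturbation bounds in the Wasserstein distance, and the conclusion. -/

namespace MDP

variable {S A : Type*} [MeasurableSpace S] [Finite A] [MetricSpace A]
  [MeasurableSpace A] [DiscreteMeasurableSpace A]
  (M : MDP S A) (π π' : Kernel S A) [IsMarkovKernel π] [IsMarkovKernel π']

/-- The mean under `π` is zero, so this mean is a difference of expectations under `π'` and `π`. -/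
theorem abs_meanAdvantage_le {B : ℝ} (hr : ∀ x, |M.r x| ≤ B) (s : S) :
    |M.meanAdvantage π π' s| ≤
      2 * M.maxAdvantage π * (maxWassersteinDist π' π / minDist A) := by
  have h := abs_integral_sub_integral_le_maxWassersteinDist π' π
    (M.abs_advantage_le_maxAdvantage π hr s) s
  have h0 : ∫ a, M.advantage π s a ∂(π s) = 0 := M.meanAdvantage_self π hr s
  rwa [h0, sub_zero] at h

theorem abs_average_stateKernel_sub_le {g : S → ℝ} {C : ℝ} (hg : Measurable g)
    (hC : ∀ s, |g s| ≤ C) (s : S) :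
    |(M.stateKernel π').average g s - (M.stateKernel π).average g s| ≤
      2 * C * (maxWassersteinDist π' π / minDist A) := by
  rw [average_stateKernel M π' hg hC, average_stateKernel M π hg hC]
  exact abs_integral_sub_integral_le_maxWassersteinDist π' π
    (fun a => abs_average_le M.P hC (s, a)) s

/-- The resolvent of `π` solves the Bellman equation of `π'` up to `γ (P_π' - P_π) R_π g`, and `|R_π
g| ≤ C / (1 - γ)`. -/
theorem abs_resolvent_sub_resolvent_le {g : S → ℝ} {C : ℝ} (hg : Measurable g)
    (hC : ∀ s, |g s| ≤ C) (s : S) :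
    |(M.stateKernel π).resolvent M.γ g s - (M.stateKernel π').resolvent M.γ g s| ≤
      M.γ * (2 * (C / (1 - M.γ)) * (maxWassersteinDist π' π / minDist A)) / (1 - M.γ) := by
  have hm := measurable_resolvent (M.stateKernel π) (γ := M.γ) hg
  have hb := abs_resolvent_le (M.stateKernel π) M.γ_nonneg M.γ_lt_one hC
  refine abs_sub_resolvent_le (M.stateKernel π') M.γ_nonneg M.γ_lt_one hg hC hm hb (fun s => ?_) s
  have h := abs_average_stateKernel_sub_le M π π' hm hb s
  have e := resolvent_eq (M.stateKernel π) M.γ_nonneg M.γ_lt_one hg hC s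
  calc _ = |M.γ * ((M.stateKernel π').average ((M.stateKernel π).resolvent M.γ g) s -
        (M.stateKernel π).average ((M.stateKernel π).resolvent M.γ g) s)| := by
        rw [abs_sub_comm, e]; ring_nf
    _ ≤ _ := by
        rw [abs_mul, abs_of_nonneg M.γ_nonneg]
        exact mul_le_mul_of_nonneg_left h M.γ_nonneg

end MDP

theorem corollary1 {S A : Type*} [MeasurableSpace S] [Finite A] [MetricSpace A]
    [MeasurableSpace A] [DiscreteMeasurableSpace A]
    (M : MDP S A) (hr : ∃ B : ℝ, ∀ x : S × A, |M.r x| ≤ B)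
    (π π' : Kernel S A) [IsMarkovKernel π] [IsMarkovKernel π'] :
    M.performance π' ≥
      M.localApprox π π' -
        M.trpoConst π / minDist A ^ 2 * maxWassersteinDist π' π ^ 2 := by
  obtain ⟨B, hr⟩ := hr
  have hf := M.measurable_meanAdvantage π π' hr
  have hC := M.abs_meanAdvantage_le π π' hr
  have hvis := M.integral_visitation π hf hC
  have hV := integrable_of_abs_le (μ := M.ρ₀) (M.measurable_stateValue π hr)
    (M.abs_stateValue_le π hr)
  have hV' := integrable_of_abs_le (μ := M.ρ₀) (M.measurable_stateValue π' hr)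
    (M.abs_stateValue_le π' hr)
  have hR := integrable_of_abs_le (μ := M.ρ₀)
    (measurable_resolvent (M.stateKernel π) (γ := M.γ) hf)
    (abs_resolvent_le (M.stateKernel π) M.γ_nonneg M.γ_lt_one hC)
  have hL : M.localApprox π π' = ∫ s, M.stateValue π s +
      (M.stateKernel π).resolvent M.γ (M.meanAdvantage π π') s ∂M.ρ₀ := by
    rw [integral_add hV hR, ← hvis, ← MDP.performance_eq M π hr]
    rfl
  set c := M.trpoConst π / minDist A ^ 2 * maxWassersteinDist π' π ^ 2 with hc
  have hpt : ∀ s, M.stateValue π s +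
      (M.stateKernel π).resolvent M.γ (M.meanAdvantage π π') s ≤ M.stateValue π' s + c := by
    intro s
    have h := (le_abs_self _).trans (M.abs_resolvent_sub_resolvent_le π π' hf hC s)
    rw [← M.stateValue_sub_stateValue π π' hr hC] at h
    -- The 4 is 2 from the bound on the mean advantage times 2 from the comparison of kernels; each
    -- brings one factor `w`.
    have e : c = M.γ * (2 * (2 * M.maxAdvantage π * (maxWassersteinDist π' π / minDist A) /
        (1 - M.γ)) * (maxWassersteinDist π' π / minDist A)) / (1 - M.γ) := by
      rw [hc, MDP.trpoConst]
      generalize 1 - M.γ = q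
      ring
    linarith
  have h := integral_mono (hV.add hR) (hV'.add (integrable_const c)) hpt
  simp only [Pi.add_apply] at h
  rw [integral_add hV' (integrable_const c), ← hL, ← MDP.performance_eq M π' hr] at h
  simp only [MeasureTheory.integral_const, probReal_univ, one_smul] at h
  linarith

end
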